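/- Let $M$ be an $n$-dimensional smooth manifold, and let $\chi(M)$ be the Lie algebra of smooth vector fields on $M$. Let $(\phi,\xi,\eta,g)$ be an LP-Sasakian structure on $M$: $\phi$ is a smooth $(1,1)$ tensor field, $\xi$ a smooth vector field, $\eta$ a smooth $1$-form and $g$ a Lorentzian metric with Levi-Civita connection $\nabla$, such that for all $X,Y\in\chi(M)$ $$\eta(\xi)=-1,\quad g(X,\xi)=\eta(X),\quad \phi^2X=X+\eta(X)\xi,\quad g(\phi X,\phi Y)=g(X,Y)+\eta(X)\eta(Y),$$ $$\nabla_X\xi=\phi X,\qquad (\nabla_X\phi)(Y)=g(X,Y)\xi+\eta(Y)X+2\eta(X)\eta(Y)\xi .$$ Let $\widetilde\nabla$ be the semi-symmetric metric connection of $M$, that is, the linear connection on $M$ with $\widetilde\nabla g=0$ and torsion $\widetilde\nabla_XY-\widetilde\nabla_YX-[X,Y]=\eta(Y)X-\eta(X)Y$; equivalently, $\widetilde\nabla_XY=\nabla_XY+\eta(Y)X-g(X,Y)\xi$. Let $R$ and $\widetilde R$ be the curvature tensors of $\nabla$ and $\widetilde\nabla$, with the convention $R(X,Y)Z=\nabla_X\nabla_YZ-\nabla_Y\nabla_XZ-\nabla_{[X,Y]}Z$,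 and put $$\Omega(X,Y)=g(X,\phi Y),\qquad \alpha(X,Y)=(\widetilde\nabla_X\eta)(Y)+\tfrac12 g(X,Y).$$ A vector field $X\in\chi(M)$ is called horizontal if $g(X,\xi)=0$. The manifold $M$ is called locally $\phi$-symmetric with respect to $\widetilde\nabla$ if $\phi^2\big((\widetilde\nabla_W\widetilde R)(X,Y)Z\big)=0$ for all horizontal vector fields $X,Y,Z,W$. **Theorem 3.1.** $M$ is locally $\phi$-symmetric with respect to $\widetilde\nabla$ if and only if, for all horizontal vector fields $X,Y,Z,W$, $$\begin{aligned}(\widetilde\nabla_W\widetilde R)(X,Y)Z=\Big[&g(R(X,Y)W,Z)-g(R(X,Y)\phi W,Z)+\alpha(X,W)g(Y,Z)-\alpha(Y,W)g(X,Z)\\&+g(X,W)\alpha(Y,Z)-g(Y,W)\alpha(X,Z)+\alpha(Y,\phi W)g(X,Z)-\alpha(X,\phi W)g(Y,Z)\\&+\Omega(Y,W)\alpha(X,Z)-\Omega(X,W)\alpha(Y,Z)+g(X,W)g(Y,Z)-g(Y,W)g(X,Z)\\&+g(Y,W)\Omega(X,Z)-g(X,W)\Omega(Y,Z)+\Omega(Y,W)g(X,Z)-\Omega(X,W)g(Y,Z)\\&+\Omega(X,W)\Omega(Y,Z)-\Omega(Y,W)\Omega(X,Z)\Big]\xi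 .\end{aligned}\tag{3.4}$$ -/

import Mathlib

open scoped Manifold ContDiff

noncomputable section

namespace LPSasakian

/-- Vector fields on an `n`-dimensional manifold `M`, with no regularity imposed. -/
abbrev Field (n : ℕ) (M : Type*) [TopologicalSpace M]
    [ChartedSpace (EuclideanSpace ℝ (Fin n)) M] :=
  (x : M) → TangentSpace (𝓡 n) x

/-- One-forms, with no regularity imposed. -/
abbrev OneForm (n : ℕ) (M : Type*) [TopologicalSpace M]
    [ChartedSpace (EuclideanSpace ℝ (Fin n)) M] :=
  (x : M) → TangentSpace (𝓡 n) x →L[ℝ] ℝ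

/-- Fields of endomorphisms of the tangent spaces, with no regularity imposed. -/
abbrev EndoField (n : ℕ) (M : Type*) [TopologicalSpace M]
    [ChartedSpace (EuclideanSpace ℝ (Fin n)) M] :=
  (x : M) → TangentSpace (𝓡 n) x →L[ℝ] TangentSpace (𝓡 n) x

/-- Affine connections: covariant derivatives on the tangent bundle. The vector `(∇_X Y)(x)` is
written `nabla Y x (X x)`. -/
abbrev Connection (n : ℕ) (M : Type*) [TopologicalSpace M]
    [ChartedSpace (EuclideanSpace ℝ (Fin n)) M] [IsManifold (𝓡 n) ∞ M] :=
  CovariantDerivative (𝓡 n) (EuclideanSpace ℝ (Fin n))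
    (TangentSpace (𝓡 n) : M → Type _)

variable {n : ℕ} {M : Type*} [TopologicalSpace M] [ChartedSpace (EuclideanSpace ℝ (Fin n)) M]
  [IsManifold (𝓡 n) ∞ M]

/-- Smooth vector fields, that is, elements of `χ(M)`. -/
def SmoothField (X : Field n M) : Prop :=
  ContMDiff (𝓡 n) (𝓡 n).tangent ∞ (fun x ↦ (⟨x, X x⟩ : TangentBundle (𝓡 n) M))

/-- Smooth one-forms, as smooth sections of the cotangent bundle. -/
def SmoothOneForm (η : OneForm n M) : Prop :=
  ContMDiff (𝓡 n) ((𝓡 n).prod 𝓘(ℝ, EuclideanSpace ℝ (Fin n) →L[ℝ] ℝ)) ∞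
    (fun x ↦ Bundle.TotalSpace.mk' (EuclideanSpace ℝ (Fin n) →L[ℝ] ℝ)
      (E := fun y : M ↦ TangentSpace (𝓡 n) y →L[ℝ] ℝ) x (η x))

/-- Smooth `(1,1)` tensor fields, as smooth sections of `Hom(TM, TM)`. -/
def SmoothEndoField (φ : EndoField n M) : Prop :=
  ContMDiff (𝓡 n)
    ((𝓡 n).prod 𝓘(ℝ, EuclideanSpace ℝ (Fin n) →L[ℝ] EuclideanSpace ℝ (Fin n))) ∞
    (fun x ↦ Bundle.TotalSpace.mk' (EuclideanSpace ℝ (Fin n) →L[ℝ] EuclideanSpace ℝ (Fin n))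
      (E := fun y : M ↦ TangentSpace (𝓡 n) y →L[ℝ] TangentSpace (𝓡 n) y) x (φ x))

variable (n M) in
/-- A smooth Lorentzian metric, of signature `(-, +, …, +)`: a smooth symmetric `(0,2)` tensor
field for which each tangent space has an orthonormal basis with exactly one timelike vector. -/
structure LorentzianMetric where
  inner (x : M) : TangentSpace (𝓡 n) x →L[ℝ] TangentSpace (𝓡 n) x →L[ℝ] ℝ
  symm (x : M) (u v : TangentSpace (𝓡 n) x) : inner x u v = inner x v u
  lorentzian (x : M) : ∃ (b : Module.Basis (Fin n) ℝ (TangentSpace (𝓡 n) x)) (i₀ : Fin n),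
    ∀ i j, inner x (b i) (b j) = if i = j then (if i = i₀ then -1 else 1) else 0
  contMDiff : ContMDiff (𝓡 n)
    ((𝓡 n).prod 𝓘(ℝ, EuclideanSpace ℝ (Fin n) →L[ℝ] EuclideanSpace ℝ (Fin n) →L[ℝ] ℝ)) ∞
    (fun x ↦ Bundle.TotalSpace.mk'
      (EuclideanSpace ℝ (Fin n) →L[ℝ] EuclideanSpace ℝ (Fin n) →L[ℝ] ℝ)
      (E := fun y : M ↦ TangentSpace (𝓡 n) y →L[ℝ] TangentSpace (𝓡 n) y →L[ℝ] ℝ) x (inner x))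

/-- The function `g(X, Y)` on `M`. -/
def LorentzianMetric.app (g : LorentzianMetric n M) (X Y : Field n M) (x : M) : ℝ :=
  g.inner x (X x) (Y x)

/-- The function `η(X)` on `M`. -/
def formApp (η : OneForm n M) (X : Field n M) (x : M) : ℝ := η x (X x)

/-- The vector field `φ X`. -/
def endoApp (φ : EndoField n M) (X : Field n M) : Field n M := fun x ↦ φ x (X x)

/-- The derivative `X f` of a function along a vector field. -/
def dirDeriv (X : Field n M) (f : M → ℝ) (x : M) : ℝ :=
  mvfderiv (𝓡 n) f x (X x)

/-- The vector field `∇_X Y`. -/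
def covField (nabla : Connection n M) (X Y : Field n M) : Field n M :=
  fun x ↦ nabla Y x (X x)

/-- `∇ g = 0`, that is, `X g(Y, Z) = g(∇_X Y, Z) + g(Y, ∇_X Z)`. -/
def IsMetric (g : LorentzianMetric n M) (nabla : Connection n M) : Prop :=
  ∀ X Y Z : Field n M, SmoothField X → SmoothField Y → SmoothField Z → ∀ x : M,
    dirDeriv X (g.app Y Z) x = g.app (covField nabla X Y) Z x + g.app Y (covField nabla X Z) x

/-- `∇` is the Levi-Civita connection of `g`: smooth, torsion-free and metric. -/
structure IsLeviCivita (g : LorentzianMetric n M) (nabla : Connection n M) : Prop where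
  smooth : nabla.ContMDiffCovariantDerivative ∞
  torsion_eq_zero : nabla.torsion = 0
  metric : IsMetric g nabla

/-- `(φ, ξ, η, g)` is an LP-Sasakian structure on `M`, where `∇` stands for the Levi-Civita
connection of `g`. -/
structure IsLPSasakian (g : LorentzianMetric n M) (nabla : Connection n M)
    (φ : EndoField n M) (ξ : Field n M) (η : OneForm n M) : Prop where
  smooth_phi : SmoothEndoField φ
  smooth_xi : SmoothField ξ
  smooth_eta : SmoothOneForm η
  eta_xi (x : M) : η x (ξ x) = -1
  inner_xi (x : M) (v : TangentSpace (𝓡 n) x) : g.inner x v (ξ x) = η x v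
  phi_phi (x : M) (v : TangentSpace (𝓡 n) x) : φ x (φ x v) = v + η x v • ξ x
  inner_phi_phi (x : M) (u v : TangentSpace (𝓡 n) x) :
    g.inner x (φ x u) (φ x v) = g.inner x u v + η x u * η x v
  nabla_xi (x : M) (v : TangentSpace (𝓡 n) x) : nabla ξ x v = φ x v
  /-- `(∇_X φ)(Y) = ∇_X (φ Y) - φ (∇_X Y) = g(X, Y) ξ + η(Y) X + 2 η(X) η(Y) ξ`. -/
  nabla_phi (X Y : Field n M) (hX : SmoothField X) (hY : SmoothField Y) (x : M) :
    covField nabla X (endoApp φ Y) x - φ x (covField nabla X Y x)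
      = g.app X Y x • ξ x + formApp η Y x • X x + (2 * formApp η X x * formApp η Y x) • ξ x

/-- `∇̃` is a semi-symmetric metric connection: a smooth connection with `∇̃ g = 0` and torsion
`τ(X, Y) = η(Y) X - η(X) Y`. -/
structure IsSemiSymmetricMetric (g : LorentzianMetric n M) (η : OneForm n M)
    (nabla' : Connection n M) : Prop where
  smooth : nabla'.ContMDiffCovariantDerivative ∞
  torsion_eq (x : M) (u v : TangentSpace (𝓡 n) x) :
    nabla'.torsion x u v = η x v • u - η x u • v
  metric : IsMetric g nabla'

/-- The curvature `R(X, Y) Z = ∇_X ∇_Y Z - ∇_Y ∇_X Z - ∇_[X,Y] Z`. -/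
def curvature (nabla : Connection n M) (X Y Z : Field n M) : Field n M :=
  covField nabla X (covField nabla Y Z) - covField nabla Y (covField nabla X Z)
    - covField nabla (VectorField.mlieBracket (𝓡 n) X Y) Z

/-- The covariant derivative `(∇_W R)(X, Y) Z` of the curvature tensor `R` of `∇`. -/
def covCurvature (nabla : Connection n M) (W X Y Z : Field n M) : Field n M :=
  covField nabla W (curvature nabla X Y Z)
    - curvature nabla (covField nabla W X) Y Z
    - curvature nabla X (covField nabla W Y) Z
    - curvature nabla X Y (covField nabla W Z)

/-- `(∇_X η)(Y) = X (η(Y)) - η(∇_X Y)`. -/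
def covForm (nabla : Connection n M) (η : OneForm n M) (X Y : Field n M) (x : M) : ℝ :=
  dirDeriv X (formApp η Y) x - formApp η (covField nabla X Y) x

/-- `Ω(X, Y) = g(X, φ Y)`. -/
def Omega (g : LorentzianMetric n M) (φ : EndoField n M) (X Y : Field n M) (x : M) : ℝ :=
  g.app X (endoApp φ Y) x

/-- `α(X, Y) = (∇̃_X η)(Y) + g(X, Y) / 2`. -/
def alpha (g : LorentzianMetric n M) (nabla' : Connection n M) (η : OneForm n M)
    (X Y : Field n M) (x : M) : ℝ :=
  covForm nabla' η X Y x + (1 / 2) * g.app X Y x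

/-- Horizontal vector fields: smooth and orthogonal to `ξ`. -/
structure IsHorizontal (g : LorentzianMetric n M) (ξ X : Field n M) : Prop where
  smooth : SmoothField X
  orthogonal (x : M) : g.app X ξ x = 0

/-- Local `φ`-symmetry with respect to `∇̃`: `φ² ((∇̃_W R̃)(X, Y) Z) = 0` for all horizontal
vector fields `X`, `Y`, `Z`, `W`. -/
def IsLocallyPhiSymmetric (g : LorentzianMetric n M) (φ : EndoField n M) (ξ : Field n M)
    (nabla' : Connection n M) : Prop :=
  ∀ X Y Z W : Field n M, IsHorizontal g ξ X → IsHorizontal g ξ Y → IsHorizontal g ξ Z →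
    IsHorizontal g ξ W → ∀ x : M, φ x (φ x (covCurvature nabla' W X Y Z x)) = 0

end LPSasakian

end

noncomputable section

namespace LPSasakian

variable {n : ℕ} {M : Type*} [TopologicalSpace M] [ChartedSpace (EuclideanSpace ℝ (Fin n)) M]
  [IsManifold (𝓡 n) ∞ M]

/-! ### Smoothness of the tensor operations and global extension of tangent vectors. -/

section Smoothness

/-! Since `φ² v = v + η(v) ξ`, the vector `φ² v` vanishes exactly when `v = -η(v) ξ`. So only the
`ξ`-component of `(∇̃_W R̃)(X, Y) Z` has to be computed on horizontal fields, and the equivalence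
then holds for each choice of fields and point separately.

As `∇̃` is metric, `R̃(X, Y)` is skew-adjoint (`IsMetric.inner_curvature`), so `η(R̃(X, Y) Z) =
-g(Z, R̃(X, Y) ξ)`, which is explicit by `curvature_semiSymmetric_xi` and vanishes for horizontal
`X`, `Y`. Differentiating, with `∇̃_W ξ = φ W - W` for horizontal `W`, leaves `R̃(X, Y) W`, `R̃(X,
Y) φW` and products of `g` and `Ω` (`eta_covCurvature`). Finally `curvature_semiSymmetric` trades
`R̃` for `R` and `α`. -/

lemma SmoothField.mdifferentiableAt {X : Field n M} (hX : SmoothField X) (x : M) :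
    MDifferentiableAt (𝓡 n) (𝓡 n).tangent (fun x ↦ (⟨x, X x⟩ : TangentBundle (𝓡 n) M)) x :=
  (hX x).mdifferentiableAt (by simp)

lemma SmoothField.add {X Y : Field n M} (hX : SmoothField X) (hY : SmoothField Y) :
    SmoothField (X + Y) :=
  ContMDiff.add_section hX hY

lemma SmoothField.sub {X Y : Field n M} (hX : SmoothField X) (hY : SmoothField Y) :
    SmoothField (X - Y) :=
  ContMDiff.sub_section hX hY

lemma SmoothField.smul {f : M → ℝ} {X : Field n M} (hf : ContMDiff (𝓡 n) 𝓘(ℝ, ℝ) ∞ f)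
    (hX : SmoothField X) : SmoothField (f • X) :=
  ContMDiff.smul_section hf hX

lemma SmoothField.endoApp {φ : EndoField n M} {X : Field n M} (hφ : SmoothEndoField φ)
    (hX : SmoothField X) : SmoothField (endoApp φ X) :=
  ContMDiff.clm_bundle_apply hφ hX

lemma SmoothOneForm.contMDiff_formApp {η : OneForm n M} {X : Field n M} (hη : SmoothOneForm η)
    (hX : SmoothField X) : ContMDiff (𝓡 n) 𝓘(ℝ, ℝ) ∞ (formApp η X) := by
  have h : ContMDiff (𝓡 n) ((𝓡 n).prod 𝓘(ℝ, ℝ)) ∞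
      (fun x ↦ Bundle.TotalSpace.mk' ℝ (E := Bundle.Trivial M ℝ) x (η x (X x))) :=
    ContMDiff.clm_bundle_apply (F₁ := EuclideanSpace ℝ (Fin n)) (F₂ := ℝ)
      (E₂ := Bundle.Trivial M ℝ) hη hX
  exact fun x ↦ (Bundle.contMDiffAt_section x).1 (h x)

lemma LorentzianMetric.contMDiff_app (g : LorentzianMetric n M) {X Y : Field n M}
    (hX : SmoothField X) (hY : SmoothField Y) :
    ContMDiff (𝓡 n) 𝓘(ℝ, ℝ) ∞ (g.app X Y) := by
  have h : SmoothOneForm (fun x ↦ g.inner x (X x)) :=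
    ContMDiff.clm_bundle_apply (F₁ := EuclideanSpace ℝ (Fin n))
      (F₂ := EuclideanSpace ℝ (Fin n) →L[ℝ] ℝ)
      (E₂ := fun y : M ↦ TangentSpace (𝓡 n) y →L[ℝ] ℝ) g.contMDiff hX
  exact h.contMDiff_formApp hY

lemma SmoothField.covField {nabla : Connection n M}
    (h : nabla.ContMDiffCovariantDerivative ∞) {X Y : Field n M}
    (hX : SmoothField X) (hY : SmoothField Y) : SmoothField (covField nabla X Y) := by
  have := h.contMDiff.contMDiff (σ := Y) (by simpa using ContMDiff.contMDiffOn hY)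
  exact ContMDiff.clm_bundle_apply (contMDiffOn_univ.1 this) hX

lemma SmoothField.mlieBracket {X Y : Field n M} (hX : SmoothField X) (hY : SmoothField Y) :
    SmoothField (VectorField.mlieBracket (𝓡 n) X Y) := by
  have : IsManifold (𝓡 n) ((⊤ : ℕ∞) + 1) M := by simpa
  have : IsManifold (𝓡 n) (minSmoothness ℝ 2) M := IsManifold.of_le (n := ∞) (by simpa using ENat.LEInfty.out)
  exact ContDiff.mlieBracket_vectorField (m := ⊤) (n := ⊤) hX hY (by simp)

/-- A local smooth extension is cut off by a bump function. This allows pointwise identities to be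
tested against global smooth fields, the only ones the metric condition speaks of. -/
lemma exists_smoothField_apply_eq [T2Space M] (x : M) (v : TangentSpace (𝓡 n) x) :
    ∃ X : Field n M, SmoothField X ∧ X x = v := by
  obtain ⟨s, hs, hsσ⟩ := FiberBundle.exists_contMDiffOn_extend (𝕜 := ℝ) (k := ∞) (𝓡 n)
    (EuclideanSpace ℝ (Fin n)) v
  obtain ⟨f, hf, -⟩ := (SmoothBumpFunction.nhds_basis_support (I := 𝓡 n)
    (interior_mem_nhds.2 hs)).mem_iff.1 Filter.univ_mem
  refine ⟨(f : M → ℝ) • FiberBundle.extend (EuclideanSpace ℝ (Fin n)) v, ?_, by simp⟩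
  exact ContMDiffOn.smul_section_of_tsupport f.contMDiff.contMDiffOn isOpen_interior hf
    (hsσ.mono interior_subset)

end Smoothness

/-! ### Leibniz rules and the bracket as a commutator of derivations. -/

section Derivative

lemma covField_add_apply (nabla : Connection n M) (X : Field n M) {Y Z : Field n M}
    (hY : SmoothField Y) (hZ : SmoothField Z) (x : M) :
    covField nabla X (Y + Z) x = covField nabla X Y x + covField nabla X Z x := by
  exact congr($(nabla.isCovariantDerivativeOnUniv.add (hY.mdifferentiableAt x)
    (hZ.mdifferentiableAt x)) (X x))

lemma covField_smul_apply (nabla : Connection n M) (X : Field n M) {f : M → ℝ} {Y : Field n M}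
    (hf : ContMDiff (𝓡 n) 𝓘(ℝ, ℝ) ∞ f) (hY : SmoothField Y) (x : M) :
    covField nabla X (f • Y) x = f x • covField nabla X Y x + dirDeriv X f x • Y x := by
  exact congr($(nabla.isCovariantDerivativeOnUniv.leibniz (hY.mdifferentiableAt x)
    ((hf x).mdifferentiableAt (by simp))) (X x))

lemma covField_sub_apply (nabla : Connection n M) (X : Field n M) {Y Z : Field n M}
    (hY : SmoothField Y) (hZ : SmoothField Z) (x : M) :
    covField nabla X (Y - Z) x = covField nabla X Y x - covField nabla X Z x := by
  have h := covField_add_apply nabla X (hY.sub hZ) hZ x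
  rw [sub_add_cancel] at h
  rw [h, add_sub_cancel_right]

lemma dirDeriv_add {X : Field n M} {f h : M → ℝ} (hf : ContMDiff (𝓡 n) 𝓘(ℝ, ℝ) ∞ f)
    (hh : ContMDiff (𝓡 n) 𝓘(ℝ, ℝ) ∞ h) (x : M) :
    dirDeriv X (f + h) x = dirDeriv X f x + dirDeriv X h x := by
  simp [dirDeriv, mvfderiv_add ((hf x).mdifferentiableAt (by simp))
    ((hh x).mdifferentiableAt (by simp))]

lemma dirDeriv_const (X : Field n M) (c : ℝ) (x : M) :
    dirDeriv X (fun _ ↦ c) x = 0 := by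
  simp [dirDeriv, mvfderiv_const]

/-- `[X, Y] f = X (Y f) - Y (X f)`. -/
lemma dirDeriv_mlieBracket [T2Space M] {X Y : Field n M} (hX : SmoothField X) (hY : SmoothField Y)
    {f : M → ℝ} (hf : ContMDiff (𝓡 n) 𝓘(ℝ, ℝ) ∞ f)
    (hXf : ContMDiff (𝓡 n) 𝓘(ℝ, ℝ) ∞ (dirDeriv X f))
    (hYf : ContMDiff (𝓡 n) 𝓘(ℝ, ℝ) ∞ (dirDeriv Y f)) (x : M) :
    dirDeriv (VectorField.mlieBracket (𝓡 n) X Y) f x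
      = dirDeriv X (dirDeriv Y f) x - dirDeriv Y (dirDeriv X f) x := by
  have : IsManifold (𝓡 n) (minSmoothness ℝ 3) M :=
    IsManifold.of_le (n := ∞) (by simpa using ENat.LEInfty.out)
  have h2 : minSmoothness ℝ 2 ≤ ∞ := by simpa using ENat.LEInfty.out
  -- Compare the Jacobi identity for `X`, `Y`, `f • Z` with `f` times the one for `X`, `Y`, `Z`:
  -- after the Leibniz rule only the second-order terms in `f` survive.
  have key (Z : Field n M) (hZ : SmoothField Z) :
      (dirDeriv X (dirDeriv Y f) x - dirDeriv Y (dirDeriv X f) x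
        - dirDeriv (VectorField.mlieBracket (𝓡 n) X Y) f x) • Z x = 0 := by
    have jacobi {W : Field n M} (hW : SmoothField W) :=
      VectorField.leibniz_identity_mlieBracket_apply (I := 𝓡 n) (x := x)
        ((hX x).of_le h2) ((hY x).of_le h2)
        ((hW x).of_le h2)
    have leibniz (V : Field n M) {W : Field n M} (hW : SmoothField W) {h : M → ℝ}
        (hh : ContMDiff (𝓡 n) 𝓘(ℝ, ℝ) ∞ h) : VectorField.mlieBracket (𝓡 n) V (h • W)
          = dirDeriv V h • W + h • VectorField.mlieBracket (𝓡 n) V W := by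
      ext1 y
      exact VectorField.mlieBracket_smul_right ((hh y).mdifferentiableAt (by simp))
        (hW.mdifferentiableAt y)
    have h₁ := jacobi (hZ.smul hf)
    have h₂ := jacobi hZ
    have hXZ := hX.mlieBracket hZ
    have hYZ := hY.mlieBracket hZ
    rw [leibniz Y hZ hf, leibniz X hZ hf,
      VectorField.mlieBracket_add_right ((hZ.smul hYf).mdifferentiableAt x)
        ((hYZ.smul hf).mdifferentiableAt x),
      VectorField.mlieBracket_add_right ((hZ.smul hXf).mdifferentiableAt x)
        ((hXZ.smul hf).mdifferentiableAt x),
      leibniz X hZ hYf, leibniz Y hZ hXf, leibniz X hYZ hf, leibniz Y hXZ hf,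
      leibniz _ hZ hf] at h₁
    simp only [Pi.add_apply, Pi.smul_apply', h₂] at h₁
    linear_combination (norm := module) h₁
  -- A nonzero scalar would force the tangent space at `x` to be zero, where both sides vanish
  -- anyway.
  by_contra hne
  have hv (v : TangentSpace (𝓡 n) x) : v = 0 := by
    obtain ⟨Z, hZ, rfl⟩ := exists_smoothField_apply_eq x v
    exact (smul_eq_zero.1 (key Z hZ)).resolve_left fun h ↦ hne (sub_eq_zero.1 h).symm
  exact hne (by simp [dirDeriv, hv (X x), hv (Y x), hv (VectorField.mlieBracket (𝓡 n) X Y x)])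

end Derivative

section Metric

lemma LorentzianMetric.nondegenerate (g : LorentzianMetric n M) {x : M}
    {u : TangentSpace (𝓡 n) x} (h : ∀ v, g.inner x u v = 0) : u = 0 := by
  obtain ⟨b, i₀, hb⟩ := g.lorentzian x
  have hu := b.sum_repr u
  rw [← b.repr.map_eq_zero_iff]
  ext i
  have hi := h (b i)
  rw [← hu] at hi
  simp only [map_sum, map_smul, sum_apply, smul_apply, hb,
    smul_eq_mul, mul_ite, mul_zero, Finset.sum_ite_eq', Finset.mem_univ, if_true] at hi
  split_ifs at hi <;> simpa using hi

end Metric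

/-! ### Curvature of a metric connection. -/

section Curvature

lemma curvature_apply (nabla : Connection n M) (X Y Z : Field n M) (x : M) :
    curvature nabla X Y Z x = covField nabla X (covField nabla Y Z) x
      - covField nabla Y (covField nabla X Z) x
      - covField nabla (VectorField.mlieBracket (𝓡 n) X Y) Z x := rfl

lemma SmoothField.curvature {nabla : Connection n M}
    (h : nabla.ContMDiffCovariantDerivative ∞) {X Y Z : Field n M} (hX : SmoothField X)
    (hY : SmoothField Y) (hZ : SmoothField Z) : SmoothField (curvature nabla X Y Z) :=
  ((hX.covField h (hY.covField h hZ)).sub (hY.covField h (hX.covField h hZ))).sub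
    ((hX.mlieBracket hY).covField h hZ)

lemma IsMetric.dirDeriv_app {g : LorentzianMetric n M} {nabla : Connection n M}
    (h : IsMetric g nabla) {X Y Z : Field n M} (hX : SmoothField X) (hY : SmoothField Y)
    (hZ : SmoothField Z) :
    dirDeriv X (g.app Y Z) = g.app (covField nabla X Y) Z + g.app Y (covField nabla X Z) :=
  funext (h X Y Z hX hY hZ)

/-- The curvature operators of a metric connection are skew-adjoint. -/
lemma IsMetric.inner_curvature [T2Space M] {g : LorentzianMetric n M} {nabla : Connection n M}
    (h : IsMetric g nabla) (hs : nabla.ContMDiffCovariantDerivative ∞) {X Y Z V : Field n M}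
    (hX : SmoothField X) (hY : SmoothField Y) (hZ : SmoothField Z) (hV : SmoothField V) (x : M) :
    g.inner x (curvature nabla X Y Z x) (V x) = - g.inner x (Z x) (curvature nabla X Y V x) := by
  have hXZ := hX.covField hs hZ
  have hYZ := hY.covField hs hZ
  have hXV := hX.covField hs hV
  have hYV := hY.covField hs hV
  have hXf := h.dirDeriv_app hX hZ hV
  have hYf := h.dirDeriv_app hY hZ hV
  -- Apply `[X, Y] = XY - YX` to the function `g(Z, V)`; the mixed first-derivative terms cancel.
  have hb := dirDeriv_mlieBracket hX hY (g.contMDiff_app hZ hV)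
    (hXf ▸ (g.contMDiff_app hXZ hV).add (g.contMDiff_app hZ hXV))
    (hYf ▸ (g.contMDiff_app hYZ hV).add (g.contMDiff_app hZ hYV)) x
  rw [hXf, hYf, h.dirDeriv_app (hX.mlieBracket hY) hZ hV,
    dirDeriv_add (g.contMDiff_app hYZ hV) (g.contMDiff_app hZ hYV),
    dirDeriv_add (g.contMDiff_app hXZ hV) (g.contMDiff_app hZ hXV),
    h.dirDeriv_app hX hYZ hV, h.dirDeriv_app hX hZ hYV, h.dirDeriv_app hY hXZ hV,
    h.dirDeriv_app hY hZ hXV] at hb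
  simp only [Pi.add_apply, LorentzianMetric.app] at hb
  simp only [curvature_apply, map_sub, sub_apply]
  linarith

end Curvature

/-! ### Uniqueness of the semi-symmetric metric connection. -/

section SemiSymmetric

lemma covField_sub_covField_swap (nabla : Connection n M) {X Y : Field n M} (hX : SmoothField X)
    (hY : SmoothField Y) (x : M) :
    covField nabla X Y x - covField nabla Y X x
      = nabla.torsion x (X x) (Y x) + VectorField.mlieBracket (𝓡 n) X Y x := by
  rw [nabla.torsion_apply (hX.mdifferentiableAt x) (hY.mdifferentiableAt x)]
  exact (sub_add_cancel _ _).symm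

/-- The semi-symmetric metric connection in terms of the Levi-Civita connection. -/
lemma IsSemiSymmetricMetric.covField_eq [T2Space M] {g : LorentzianMetric n M}
    {nabla nabla' : Connection n M} {ξ : Field n M} {η : OneForm n M}
    (hη : ∀ (x : M) (v : TangentSpace (𝓡 n) x), g.inner x v (ξ x) = η x v)
    (h : IsLeviCivita g nabla) (h' : IsSemiSymmetricMetric g η nabla') {X Y : Field n M}
    (hX : SmoothField X) (hY : SmoothField Y) :
    covField nabla' X Y = covField nabla X Y + formApp η Y • X - g.app X Y • ξ := by
  ext1 x
  -- The defect `E` is symmetric in its first two slots by the torsions and skew in its last two by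
  -- metricity; alternating the two swaps gives `E = -E`, as in Koszul's argument.
  let E (X Y Z : Field n M) : ℝ := g.inner x (covField nabla' X Y x
    - (covField nabla X Y x + η x (Y x) • X x - g.inner x (X x) (Y x) • ξ x)) (Z x)
  have hE_symm {X Y : Field n M} (hX : SmoothField X) (hY : SmoothField Y) (Z : Field n M) :
      E X Y Z = E Y X Z := by
    have h₁ := covField_sub_covField_swap nabla hX hY x
    have h₂ := covField_sub_covField_swap nabla' hX hY x
    rw [h.torsion_eq_zero] at h₁
    rw [h'.torsion_eq] at h₂
    simp only [E]
    congr 2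
    rw [g.symm x (Y x)]
    simp only [Pi.zero_apply, zero_apply, zero_add] at h₁
    linear_combination (norm := module) h₂ - h₁
  have hE_anti {X Y Z : Field n M} (hX : SmoothField X) (hY : SmoothField Y)
      (hZ : SmoothField Z) : E X Y Z = - E X Z Y := by
    have h₁ := h.metric X Y Z hX hY hZ x
    have h₂ := h'.metric X Y Z hX hY hZ x
    simp only [LorentzianMetric.app] at h₁ h₂
    simp only [E, map_sub, map_add, map_smul, sub_apply, add_apply, smul_apply, smul_eq_mul,
      g.symm x (ξ x), hη, g.symm x _ (Y x)]
    linarith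
  rw [← sub_eq_zero]
  refine g.nondegenerate fun v ↦ ?_
  obtain ⟨Z, hZ, rfl⟩ := exists_smoothField_apply_eq x v
  change E X Y Z = 0
  linarith [hE_anti hX hY hZ, hE_symm hX hZ Y, hE_anti hZ hX hY, hE_symm hZ hY X,
    hE_anti hY hZ hX, hE_symm hY hX Z]

end SemiSymmetric

/-! ### Algebra and curvature of LP-Sasakian structures. -/

namespace IsLPSasakian

variable {g : LorentzianMetric n M} {nabla nabla' : Connection n M} {φ : EndoField n M}
  {ξ : Field n M} {η : OneForm n M}

lemma xi_ne_zero (hM : IsLPSasakian g nabla φ ξ η) (x : M) : ξ x ≠ 0 := fun h ↦ by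
  simpa [h] using hM.eta_xi x

/-- From `φ² ξ = 0`, the formula for `φ²` at `φ ξ` gives `0 = φξ + η(φξ) ξ`; applying `φ` once more
gives `η(φξ) φξ = 0`. -/
lemma phi_xi (hM : IsLPSasakian g nabla φ ξ η) (x : M) : φ x (ξ x) = 0 := by
  have h₂ : φ x (φ x (ξ x)) = 0 := by simp [hM.phi_phi, hM.eta_xi]
  have h₃ := hM.phi_phi x (φ x (ξ x))
  rw [h₂, map_zero] at h₃
  have h₄ := congr(φ x $h₃)
  simp only [map_zero, map_add, map_smul, h₂, zero_add] at h₄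
  rcases smul_eq_zero.1 h₄.symm with h | h
  · simpa [h] using h₃.symm
  · exact h

/-- Compute `φ³ v` both as `φ(φ² v)` and as `φ²(φ v)`. -/
lemma eta_phi (hM : IsLPSasakian g nabla φ ξ η) (x : M) (v : TangentSpace (𝓡 n) x) :
    η x (φ x v) = 0 := by
  have h := hM.phi_phi x (φ x v)
  rw [hM.phi_phi x v, map_add, map_smul, hM.phi_xi, smul_zero, add_zero, left_eq_add] at h
  exact (smul_eq_zero.1 h).resolve_right (hM.xi_ne_zero x)

lemma inner_phi (hM : IsLPSasakian g nabla φ ξ η) (x : M) (u v : TangentSpace (𝓡 n) x) :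
    g.inner x (φ x u) v = g.inner x u (φ x v) := by
  have h := hM.inner_phi_phi x u (φ x v)
  rw [hM.phi_phi, map_add, map_smul, hM.inner_xi, hM.eta_phi, hM.eta_phi] at h
  simpa using h

lemma phi_phi_eq_zero_iff (hM : IsLPSasakian g nabla φ ξ η) (x : M)
    (v : TangentSpace (𝓡 n) x) : φ x (φ x v) = 0 ↔ v = (-η x v) • ξ x := by
  rw [hM.phi_phi, add_eq_zero_iff_eq_neg, neg_smul]

lemma covField_xi (hM : IsLPSasakian g nabla φ ξ η) (X : Field n M) :
    covField nabla X ξ = endoApp φ X :=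
  funext fun x ↦ hM.nabla_xi x (X x)

lemma app_xi (hM : IsLPSasakian g nabla φ ξ η) (X : Field n M) : g.app X ξ = formApp η X :=
  funext fun x ↦ hM.inner_xi x (X x)

/-- Because `∇ξ = φ` and the torsion vanishes, the left side is `(∇_X φ) Y - (∇_Y φ) X`, in which
the symmetric terms cancel. -/
lemma curvature_xi (hM : IsLPSasakian g nabla φ ξ η) (h : IsLeviCivita g nabla) {X Y : Field n M}
    (hX : SmoothField X) (hY : SmoothField Y) (x : M) :
    curvature nabla X Y ξ x = η x (Y x) • X x - η x (X x) • Y x := by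
  have h₁ := hM.nabla_phi X Y hX hY x
  have h₂ := hM.nabla_phi Y X hY hX x
  have h₃ := congr(φ x $(covField_sub_covField_swap nabla hX hY x))
  rw [h.torsion_eq_zero] at h₃
  simp only [Pi.zero_apply, zero_apply, zero_add, map_sub] at h₃
  rw [curvature_apply, hM.covField_xi, hM.covField_xi, hM.covField_xi]
  simp only [LorentzianMetric.app, g.symm x (Y x), formApp] at h₁ h₂
  simp only [endoApp] at h₃ ⊢
  linear_combination (norm := module) h₁ - h₂ + h₃

/-- The derivative `∇̃_v ξ`. -/
lemma covField_semiSymmetric_xi [T2Space M] (hM : IsLPSasakian g nabla φ ξ η)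
    (h : IsLeviCivita g nabla) (h' : IsSemiSymmetricMetric g η nabla') {X : Field n M}
    (hX : SmoothField X) (x : M) :
    covField nabla' X ξ x = φ x (X x) - X x - η x (X x) • ξ x := by
  rw [h'.covField_eq hM.inner_xi h hX hM.smooth_xi, hM.covField_xi, hM.app_xi]
  simp only [Pi.add_apply, Pi.sub_apply, Pi.smul_apply', endoApp, formApp, hM.eta_xi]
  module

lemma alpha_eq [T2Space M] (hM : IsLPSasakian g nabla φ ξ η)
    (h : IsLeviCivita g nabla) (h' : IsSemiSymmetricMetric g η nabla') {X Y : Field n M}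
    (hX : SmoothField X) (hY : SmoothField Y) (x : M) :
    alpha g nabla' η X Y x = g.inner x (X x) (φ x (Y x)) - η x (X x) * η x (Y x)
      - 1 / 2 * g.inner x (X x) (Y x) := by
  rw [alpha, covForm, ← hM.app_xi, h'.metric X Y ξ hX hY hM.smooth_xi]
  simp only [LorentzianMetric.app, hM.covField_semiSymmetric_xi h h' hX, map_sub, map_smul,
    hM.inner_xi, formApp, smul_eq_mul]
  rw [g.symm x (Y x) (X x), g.symm x (Y x), hM.inner_phi]
  ring

/-- The curvature of the semi-symmetric metric connection in terms of that of the Levi-Civita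
connection. -/
lemma curvature_semiSymmetric [T2Space M] (hM : IsLPSasakian g nabla φ ξ η)
    (h : IsLeviCivita g nabla) (h' : IsSemiSymmetricMetric g η nabla') {X Y Z : Field n M}
    (hX : SmoothField X) (hY : SmoothField Y) (hZ : SmoothField Z) (x : M) :
    curvature nabla' X Y Z x = curvature nabla X Y Z x
      - alpha g nabla' η Y Z x • X x + alpha g nabla' η X Z x • Y x
      - g.app Y Z x • (φ x (X x) - η x (X x) • ξ x - (1 / 2 : ℝ) • X x)
      + g.app X Z x • (φ x (Y x) - η x (Y x) • ξ x - (1 / 2 : ℝ) • Y x) := by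
  -- The second derivative is written through `∇` alone, with `X(η(Z))` expanded via `η(Z) = g(Z,
  -- ξ)`; it is then skew-symmetrised in `X`, `Y`.
  have second {X Y : Field n M} (hX : SmoothField X) (hY : SmoothField Y) :
      covField nabla' X (covField nabla' Y Z) x
        = covField nabla X (covField nabla Y Z) x + η x (covField nabla Y Z x) • X x
          - g.inner x (X x) (covField nabla Y Z x) • ξ x
          + (η x (Z x) • (covField nabla X Y x + η x (Y x) • X x - g.inner x (X x) (Y x) • ξ x)
            + (η x (covField nabla X Z x) + g.inner x (Z x) (φ x (X x))) • Y x)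
          - (g.inner x (Y x) (Z x) • (φ x (X x) - X x - η x (X x) • ξ x)
            + (g.inner x (covField nabla X Y x) (Z x)
              + g.inner x (Y x) (covField nabla X Z x)) • ξ x) := by
    have hYZ := hY.covField h.smooth hZ
    have hη := hM.smooth_eta.contMDiff_formApp hZ
    have hg := g.contMDiff_app hY hZ
    rw [h'.covField_eq hM.inner_xi h hY hZ,
      covField_sub_apply _ _ (hYZ.add (hY.smul hη)) (hM.smooth_xi.smul hg),
      covField_add_apply _ _ hYZ (hY.smul hη), covField_smul_apply _ _ hη hY,
      covField_smul_apply _ _ hg hM.smooth_xi, hM.covField_semiSymmetric_xi h h' hX,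
      h'.covField_eq hM.inner_xi h hX hYZ, h'.covField_eq hM.inner_xi h hX hY,
      h.metric X Y Z hX hY hZ, ← hM.app_xi Z, h.metric X Z ξ hX hZ hM.smooth_xi, hM.covField_xi]
    simp only [Pi.add_apply, Pi.sub_apply, Pi.smul_apply', LorentzianMetric.app, formApp, endoApp,
      hM.inner_xi]
  have hb := covField_sub_covField_swap nabla hX hY x
  rw [h.torsion_eq_zero] at hb
  simp only [Pi.zero_apply, zero_apply, zero_add] at hb
  rw [curvature_apply, second hX hY, second hY hX,
    h'.covField_eq hM.inner_xi h (hX.mlieBracket hY) hZ, curvature_apply,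
    hM.alpha_eq h h' hX hZ, hM.alpha_eq h h' hY hZ]
  simp only [Pi.add_apply, Pi.sub_apply, Pi.smul_apply', LorentzianMetric.app, formApp, ← hb,
    map_sub, sub_apply, g.symm x (Z x), hM.inner_phi, g.symm x (Y x) (X x)]
  module

lemma curvature_semiSymmetric_xi [T2Space M] (hM : IsLPSasakian g nabla φ ξ η)
    (h : IsLeviCivita g nabla) (h' : IsSemiSymmetricMetric g η nabla') {X Y : Field n M}
    (hX : SmoothField X) (hY : SmoothField Y) (x : M) :
    curvature nabla' X Y ξ x
      = η x (Y x) • (X x - φ x (X x)) - η x (X x) • (Y x - φ x (Y x)) := by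
  rw [hM.curvature_semiSymmetric h h' hX hY hM.smooth_xi, hM.curvature_xi h hX hY,
    hM.alpha_eq h h' hX hM.smooth_xi, hM.alpha_eq h h' hY hM.smooth_xi]
  simp only [LorentzianMetric.app, hM.inner_xi, hM.phi_xi, map_zero, hM.eta_xi]
  module

lemma eta_eq_zero (hM : IsLPSasakian g nabla φ ξ η) {X : Field n M} (hX : IsHorizontal g ξ X)
    (x : M) : η x (X x) = 0 := by
  rw [← hM.inner_xi]
  exact hX.orthogonal x

/-- The component along `ξ` of the covariant derivative of the curvature on horizontal fields. -/
lemma eta_covCurvature [T2Space M] (hM : IsLPSasakian g nabla φ ξ η)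
    (h : IsLeviCivita g nabla) (h' : IsSemiSymmetricMetric g η nabla') {W X Y Z : Field n M}
    (hW : IsHorizontal g ξ W) (hX : IsHorizontal g ξ X) (hY : IsHorizontal g ξ Y)
    (hZ : IsHorizontal g ξ Z) (x : M) :
    -η x (covCurvature nabla' W X Y Z x)
      = g.inner x (curvature nabla' X Y W x) (Z x)
        - g.inner x (curvature nabla' X Y (endoApp φ W) x) (Z x)
        + (g.inner x (Y x) (φ x (W x)) - g.inner x (Y x) (W x))
          * (g.inner x (X x) (Z x) - g.inner x (φ x (X x)) (Z x))
        - (g.inner x (X x) (φ x (W x)) - g.inner x (X x) (W x))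
          * (g.inner x (Y x) (Z x) - g.inner x (φ x (Y x)) (Z x)) := by
  have skew {X Y Z V : Field n M} (hX : SmoothField X) (hY : SmoothField Y) (hZ : SmoothField Z)
      (hV : SmoothField V) := h'.metric.inner_curvature h'.smooth hX hY hZ hV
  have eta_curv {X Y Z : Field n M} (hX : SmoothField X) (hY : SmoothField Y)
      (hZ : SmoothField Z) (x : M) : η x (curvature nabla' X Y Z x)
        = -(η x (Y x) * (g.inner x (X x) (Z x) - g.inner x (φ x (X x)) (Z x))
          - η x (X x) * (g.inner x (Y x) (Z x) - g.inner x (φ x (Y x)) (Z x))) := by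
    rw [← hM.inner_xi, skew hX hY hZ hM.smooth_xi, g.symm,
      hM.curvature_semiSymmetric_xi h h' hX hY]
    simp only [map_sub, map_smul, sub_apply, smul_apply, smul_eq_mul]
  have eta_cov {V : Field n M} (hV : SmoothField V) (h₀ : ∀ y, η y (V y) = 0) :
      η x (covField nabla' W V x) = g.inner x (V x) (W x) - g.inner x (V x) (φ x (W x)) := by
    have hV₀ : g.app V ξ = fun _ ↦ 0 := funext fun y ↦ (hM.inner_xi y _).trans (h₀ y)
    have hd := h'.metric W V ξ hW.smooth hV hM.smooth_xi x
    rw [hV₀, dirDeriv_const] at hd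
    simp only [LorentzianMetric.app, hM.covField_semiSymmetric_xi h h' hW.smooth, map_sub,
      hM.inner_xi, hM.eta_eq_zero hW, zero_smul, map_zero] at hd
    linarith
  have hR := hX.smooth.curvature h'.smooth hY.smooth hZ.smooth
  have hWX := hW.smooth.covField h'.smooth hX.smooth
  have hWY := hW.smooth.covField h'.smooth hY.smooth
  have hWZ := hW.smooth.covField h'.smooth hZ.smooth
  have hφW := hW.smooth.endoApp hM.smooth_phi
  -- `R̃(X, Y) Z` is itself horizontal when `X` and `Y` are, so `eta_cov` applies to it.
  have hcov := eta_cov hR fun y ↦ by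
    simp [eta_curv hX.smooth hY.smooth hZ.smooth, hM.eta_eq_zero hX, hM.eta_eq_zero hY]
  simp only [covCurvature, Pi.sub_apply, map_sub]
  rw [hcov, eta_curv hWX hY.smooth hZ.smooth, eta_curv hX.smooth hWY hZ.smooth,
    eta_curv hX.smooth hY.smooth hWZ, eta_cov hX.smooth (hM.eta_eq_zero hX),
    eta_cov hY.smooth (hM.eta_eq_zero hY), hM.eta_eq_zero hX, hM.eta_eq_zero hY,
    skew hX.smooth hY.smooth hZ.smooth hW.smooth, g.symm x _ (φ x (W x))]
  have h₁ := skew hX.smooth hY.smooth hZ.smooth hφW x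
  rw [g.symm, g.symm x (Z x)] at h₁
  simp only [endoApp] at h₁
  rw [h₁, g.symm x (Z x)]
  ring

end IsLPSasakian

end LPSasakian

end

theorem theorem3p1 {n : ℕ} {M : Type*} [TopologicalSpace M]
    [ChartedSpace (EuclideanSpace ℝ (Fin n)) M] [IsManifold (𝓡 n) ∞ M]
    [T2Space M] [SecondCountableTopology M]
    (g : LPSasakian.LorentzianMetric n M)
    (nabla : LPSasakian.Connection n M) (hnabla : LPSasakian.IsLeviCivita g nabla)
    (φ : LPSasakian.EndoField n M) (ξ : LPSasakian.Field n M) (η : LPSasakian.OneForm n M)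
    (hM : LPSasakian.IsLPSasakian g nabla φ ξ η)
    (nabla' : LPSasakian.Connection n M)
    (hnabla' : LPSasakian.IsSemiSymmetricMetric g η nabla') :
    let R := LPSasakian.curvature nabla
    let f : LPSasakian.Field n M → LPSasakian.Field n M := LPSasakian.endoApp φ
    let G := g.app
    let α := LPSasakian.alpha g nabla' η
    let Ω := LPSasakian.Omega g φ
    LPSasakian.IsLocallyPhiSymmetric g φ ξ nabla' ↔
      ∀ X Y Z W : LPSasakian.Field n M,
        LPSasakian.IsHorizontal g ξ X → LPSasakian.IsHorizontal g ξ Y →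
        LPSasakian.IsHorizontal g ξ Z → LPSasakian.IsHorizontal g ξ W → ∀ x : M,
        LPSasakian.covCurvature nabla' W X Y Z x =
          (G (R X Y W) Z x - G (R X Y (f W)) Z x + α X W x * G Y Z x
            - α Y W x * G X Z x + G X W x * α Y Z x - G Y W x * α X Z x
            + α Y (f W) x * G X Z x - α X (f W) x * G Y Z x + Ω Y W x * α X Z x
            - Ω X W x * α Y Z x + G X W x * G Y Z x - G Y W x * G X Z x
            + G Y W x * Ω X Z x - G X W x * Ω Y Z x + Ω Y W x * G X Z x
            - Ω X W x * G Y Z x + Ω X W x * Ω Y Z x - Ω Y W x * Ω X Z x) • ξ x := by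
  intro R f G α Ω
  refine forall₄_congr fun X Y Z W ↦ forall₅_congr fun hX hY hZ hW x ↦ ?_
  rw [hM.phi_phi_eq_zero_iff, hM.eta_covCurvature hnabla hnabla' hW hX hY hZ]
  have hfW : LPSasakian.SmoothField (f W) := hW.smooth.endoApp hM.smooth_phi
  rw [hM.curvature_semiSymmetric hnabla hnabla' hX.smooth hY.smooth hW.smooth,
    hM.curvature_semiSymmetric hnabla hnabla' hX.smooth hY.smooth hfW,
    hM.eta_eq_zero hX, hM.eta_eq_zero hY]
  have hα {U V : LPSasakian.Field n M} (hU : LPSasakian.SmoothField U)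
      (hV : LPSasakian.SmoothField V) := hM.alpha_eq hnabla hnabla' hU hV x
  simp only [R, f, G, α, Ω]
  refine Eq.congr_right (congrArg (· • ξ x) ?_)
  -- The `α` terms involving `W` or `φW` match verbatim. Only `α(X, Z)` and `α(Y, Z)` need
  -- unfolding: they arise from the `φX - X/2` and `φY - Y/2` terms of `R̃`.
  rw [hα hX.smooth hZ.smooth, hα hY.smooth hZ.smooth]
  simp only [LPSasakian.Omega, LPSasakian.LorentzianMetric.app, LPSasakian.endoApp, map_sub,
    map_add, map_smul, sub_apply, add_apply, smul_apply, smul_eq_mul, zero_smul, hM.inner_phi,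
    hM.eta_eq_zero hX, hM.eta_eq_zero hY, sub_zero]
  ring
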